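/- Let $(\Omega,\mathcal F,P)$ be a probability space, $1<p<\infty$, $p'=\frac{p}{p-1}$ and $\alpha\in[0,1)$. A density is a random variable $Z\in L^1$ with $Z\ge 0$ and $\mathbb E Z=1$. For $Y\in L^p$, the Entropic Value-at-Risk of order $p$ at level $\alpha$ based on the Rényi entropy $H_{p'}(Z)=\frac{1}{p'-1}\log\mathbb E Z^{p'}$ is $$\mathrm{EVaR}^p_\alpha(Y)=\sup\Big\{\mathbb E\,YZ:\ Z \text{ a density with } \mathbb E Z^{p'}<\infty,\ H_{p'}(Z)\le\log\tfrac1{1-\alpha}\Big\},$$ and for $Z\in L^{p'}$ the dual norm of $\mathrm{EVaR}^p_\alpha(|\cdot|)$ is $$\|Z\|^*_{\alpha,p'}=\sup\big\{\mathbb E\,YZ:\ Y\in L^p,\ \mathrm{EVaR}^p_\alpha(|Y|)\le 1\big\}\in[0,\infty].$$ Then for every $Z\in L^{p'}$ $$\|Z\|^*_{\alpha,p'}=\sup_{t\in\mathbb R}\ \frac{\mathbb E\,\big(t+|Z|^{p'-1}\big)_+\,|Z|}{t+\big(\frac1{1-\alpha}\big)^{1/p}\,\big\|\big(t+|Z|^{p'-1}\big)_+-t\big\|_p},$$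 where a quotient $0/0$ is read as $0$. Moreover, if $\alpha>0$, then $\|Z\|^*_{\alpha,p'}<\infty$, and if in addition $Z$ is not almost surely $0$, then the denominator is positive for every $t\in\mathbb R$ (so that no quotient $0/0$ occurs). -/

import Mathlib

open MeasureTheory

/-- A density with respect to `P`: an integrable random variable `Z ≥ 0` with `E Z = 1`. -/
structure IsDensity {Ω : Type*} [MeasurableSpace Ω] (P : Measure Ω) (Z : Ω → ℝ) : Prop where
  integrable : Integrable Z P
  nonneg : 0 ≤ᵐ[P] Z
  integral_eq_one : ∫ ω, Z ω ∂P = 1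

/-- The Rényi entropy of real order `q` of a density `Z`
(meaningful when the expectation that occurs is finite). -/
noncomputable def renyiEntropy {Ω : Type*} [MeasurableSpace Ω] (P : Measure Ω) (q : ℝ)
    (Z : Ω → ℝ) : ℝ :=
  if q = 0 then -Real.log (P.real {ω | 0 < Z ω})
  else if q = 1 then ∫ ω, Z ω * Real.log (Z ω) ∂P
  else 1 / (q - 1) * Real.log (∫ ω, Z ω ^ q ∂P)

/-- The densities over which the Entropic Value-at-Risk of order `p ∈ (1, ∞)` at level `α`
is a supremum: those with finite Rényi entropy of the conjugate order `p' = p / (p - 1) > 1`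
(that is, with `E Z ^ p' < ∞`), this entropy being at most `log (1 / (1 - α))`. -/
structure IsEVaRFeasible {Ω : Type*} [MeasurableSpace Ω] (P : Measure Ω) (α p : ℝ)
    (Z : Ω → ℝ) : Prop where
  isDensity : IsDensity P Z
  integrable_rpow : Integrable (fun ω => Z ω ^ p.conjExponent) P
  entropy_le : renyiEntropy P p.conjExponent Z ≤ Real.log (1 / (1 - α))

/-- The Entropic Value-at-Risk of order `p ∈ (1, ∞)` at confidence level `α ∈ [0, 1)`
based on Rényi entropy, of `Y` in `L ^ p`: the supremum of `E Y Z` over all feasible densities. -/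
noncomputable def EVaR {Ω : Type*} [MeasurableSpace Ω] (P : Measure Ω) (α p : ℝ)
    (Y : Ω → ℝ) : EReal :=
  ⨆ (Z : Ω → ℝ) (_ : IsEVaRFeasible P α p Z), ((∫ ω, Y ω * Z ω ∂P : ℝ) : EReal)

/-- The dual norm of `Y ↦ EVaR (|Y|)` (a norm on `L ^ p`), on `Z` in `L ^ p'`: the supremum of
`E Y Z` over all `Y` in `L ^ p` with `EVaR (|Y|) ≤ 1`. -/
noncomputable def EVaRDualNorm {Ω : Type*} [MeasurableSpace Ω] (P : Measure Ω) (α p : ℝ)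
    (Z : Ω → ℝ) : EReal :=
  ⨆ (Y : Ω → ℝ) (_ : MemLp Y (ENNReal.ofReal p) P) (_ : EVaR P α p (fun ω => |Y ω|) ≤ 1),
    ((∫ ω, Y ω * Z ω ∂P : ℝ) : EReal)

/-- The numerator `E (t + |Z| ^ (p' - 1))₊ |Z|`. -/
noncomputable def dualNum {Ω : Type*} [MeasurableSpace Ω] (P : Measure Ω) (p : ℝ)
    (Z : Ω → ℝ) (t : ℝ) : ℝ :=
  ∫ ω, max (t + |Z ω| ^ (p.conjExponent - 1)) 0 * |Z ω| ∂P

/-- The denominator `t + (1 / (1 - α)) ^ (1 / p) ‖(t + |Z| ^ (p' - 1))₊ - t‖_p`. -/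
noncomputable def dualDen {Ω : Type*} [MeasurableSpace Ω] (P : Measure Ω) (α p : ℝ)
    (Z : Ω → ℝ) (t : ℝ) : ℝ :=
  t + (1 / (1 - α)) ^ (1 / p) *
    (eLpNorm (fun ω => max (t + |Z ω| ^ (p.conjExponent - 1)) 0 - t) (ENNReal.ofReal p) P).toReal

/-! ### Identities between conjugate exponents. -/

section RealPowers

/-! Write `q = p'` and `c = (1 / (1 - α)) ^ (1 / p)`. The entropy bound on a density `W` says `‖W‖_q
≤ c`. The dual norm is therefore at most `K` as soon as `|Z| ≤ K W` for a feasible `W`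
(`EVaRDualNorm_le_of_abs_le`).

Conversely, `sign(Z) (t + |Z| ^ (q - 1))₊`, divided by the denominator, is a test variable: by
Hölder the denominator bounds its `EVaR` (`integral_max_add_mul_le_dualDen`). So every quotient is a
lower bound.

For `α > 0` the bounds meet. The best majorant is `M = max |Z| s`, with `s` such that `‖M‖_q = c E
M` (`exists_truncation_level`). For `t = -s ^ (q - 1)` the variable in the denominator's norm is `M
^ (q - 1)`, the equality case of Hölder against `M`, and the quotient equals `E M`. If `s = 0`
already satisfies the constraint, the value is `E |Z|`, the limit as `t → ∞`.

For `α = 0` the constant density `1` bounds the dual norm by the essential supremum of `|Z|`, and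
the quotient at `-s ^ (q - 1)` is at least `s` whenever `|Z|` exceeds `s` with positive probability.
-/

lemma Real.HolderConjugate.sub_one_div_self {p q : ℝ} (hpq : p.HolderConjugate q) :
    (q - 1) * (1 / q) = 1 / p := by
  have h := hpq.inv_add_inv_eq_one
  have hq := hpq.symm.ne_zero
  rw [one_div, one_div, sub_mul, mul_inv_cancel₀ hq]
  linarith

lemma Real.HolderConjugate.rpow_sub_one_rpow {p q : ℝ} (hpq : p.HolderConjugate q) {x : ℝ}
    (hx : 0 ≤ x) : (x ^ (q - 1)) ^ p = x ^ q := by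
  rw [← Real.rpow_mul hx, hpq.symm.sub_one_mul_conj]

lemma Real.HolderConjugate.rpow_one_div_rpow {p q : ℝ} (hpq : p.HolderConjugate q) {x : ℝ}
    (hx : 0 ≤ x) : (x ^ (1 / p)) ^ q = x ^ (q - 1) := by
  rw [← Real.rpow_mul hx, ← hpq.sub_one_div_self, mul_assoc, one_div,
    inv_mul_cancel₀ hpq.symm.ne_zero, mul_one]

lemma Real.HolderConjugate.rpow_rpow_one_div {p q : ℝ} (hpq : p.HolderConjugate q) {x : ℝ}
    (hx : 0 ≤ x) : (x ^ q) ^ (1 / p) = x ^ (q - 1) := by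
  rw [← hpq.rpow_sub_one_rpow hx, one_div, Real.rpow_rpow_inv (Real.rpow_nonneg hx _) hpq.ne_zero]

lemma Real.rpow_eq_rpow_sub_one_mul {x q : ℝ} (hx : 0 ≤ x) (hq : 1 < q) :
    x ^ q = x ^ (q - 1) * x := by
  conv_lhs => rw [show q = (q - 1) + 1 by ring]
  rw [Real.rpow_add_one' hx (by linarith)]

end RealPowers

/-! ### Integrability and truncation from below. -/

section Truncation

variable {Ω : Type*} [MeasurableSpace Ω] {P : Measure Ω} {p q : ℝ}

lemma MeasureTheory.MemLp.integrable_rpow_of_nonneg {f : Ω → ℝ} (hq : 0 < q)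
    (hf : MemLp f (ENNReal.ofReal q) P) (h0 : 0 ≤ᵐ[P] f) : Integrable (fun ω => f ω ^ q) P := by
  have h := hf.integrable_norm_rpow (by simpa using hq) (by simp)
  rw [ENNReal.toReal_ofReal hq.le] at h
  refine h.congr ?_
  filter_upwards [h0] with ω hω
  rw [Real.norm_of_nonneg hω]

lemma MeasureTheory.MemLp.abs_apply {f : Ω → ℝ} {r : ENNReal} (hf : MemLp f r P) :
    MemLp (fun ω => |f ω|) r P :=
  hf.abs

lemma MeasureTheory.memLp_of_integrable_rpow {f : Ω → ℝ} (hq : 0 < q)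
    (hf : AEStronglyMeasurable f P) (h0 : 0 ≤ᵐ[P] f) (hi : Integrable (fun ω => f ω ^ q) P) :
    MemLp f (ENNReal.ofReal q) P := by
  rw [← integrable_norm_rpow_iff hf (by simpa using hq) (by simp), ENNReal.toReal_ofReal hq.le]
  refine hi.congr ?_
  filter_upwards [h0] with ω hω
  rw [Real.norm_of_nonneg hω]

lemma MeasureTheory.MemLp.toReal_eLpNorm_of_nonneg {f : Ω → ℝ} (hp : 0 < p)
    (hf : MemLp f (ENNReal.ofReal p) P) (h0 : ∀ ω, 0 ≤ f ω) :
    (eLpNorm f (ENNReal.ofReal p) P).toReal = (∫ ω, f ω ^ p ∂P) ^ (1 / p) := by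
  rw [toReal_eLpNorm hf.1, lpNorm_eq_integral_norm_rpow_toReal (by simpa using hp) (by simp) hf.1,
    ENNReal.toReal_ofReal hp.le, one_div]
  simp only [Real.norm_of_nonneg (h0 _)]

lemma MeasureTheory.MemLp.abs_rpow_sub_one {Z : Ω → ℝ} (hpq : p.HolderConjugate q)
    (hZ : MemLp Z (ENNReal.ofReal q) P) :
    MemLp (fun ω => |Z ω| ^ (q - 1)) (ENNReal.ofReal p) P := by
  refine memLp_of_integrable_rpow hpq.pos ?_
    (ae_of_all _ fun ω => Real.rpow_nonneg (abs_nonneg _) _) ?_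
  · exact (hZ.1.norm.aemeasurable.pow_const _).aestronglyMeasurable
  · simp only [hpq.rpow_sub_one_rpow (abs_nonneg _)]
    exact hZ.abs.integrable_rpow_of_nonneg hpq.symm.pos (ae_of_all _ fun ω => abs_nonneg _)

variable [IsProbabilityMeasure P]

lemma MeasureTheory.MemLp.max_const {f : Ω → ℝ} {r : ENNReal} (hf : MemLp f r P) (s : ℝ) :
    MemLp (fun ω => max (f ω) s) r P :=
  hf.sup (memLp_const s)

lemma MeasureTheory.MemLp.integrable_of_one_le {f : Ω → ℝ} (hq : 1 < q)
    (hf : MemLp f (ENNReal.ofReal q) P) : Integrable f P :=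
  hf.integrable (by simpa using hq.le)

lemma integral_le_integral_rpow_rpow {f : Ω → ℝ} (hpq : p.HolderConjugate q)
    (hf : MemLp f (ENNReal.ofReal q) P) (h0 : 0 ≤ᵐ[P] f) :
    ∫ ω, f ω ∂P ≤ (∫ ω, f ω ^ q ∂P) ^ (1 / q) := by
  have h := integral_mul_le_Lp_mul_Lq_of_nonneg (μ := P) hpq (f := fun _ => (1 : ℝ))
    (ae_of_all _ fun _ => zero_le_one) h0 (memLp_const 1) hf
  simpa using h

lemma continuousOn_integral_max_rpow {f : Ω → ℝ} (hq : 0 < q) (hf : MemLp f (ENNReal.ofReal q) P)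
    (h0 : ∀ ω, 0 ≤ f ω) (b : ℝ) :
    ContinuousOn (fun s => ∫ ω, max (f ω) s ^ q ∂P) (Set.Icc 0 b) := by
  refine continuousOn_of_dominated (bound := fun ω => max (f ω) b ^ q) ?_ ?_ ?_ ?_
  · intro s _
    exact ((hf.max_const s).1.aemeasurable.pow_const _).aestronglyMeasurable
  · intro s hs
    refine ae_of_all _ fun ω => ?_
    have h1 : 0 ≤ max (f ω) s := (h0 ω).trans (le_max_left _ _)
    rw [Real.norm_of_nonneg (Real.rpow_nonneg h1 _)]
    exact Real.rpow_le_rpow h1 (max_le_max le_rfl hs.2) hq.le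
  · exact (hf.max_const b).integrable_rpow_of_nonneg hq
      (ae_of_all _ fun ω => (h0 ω).trans (le_max_left _ _))
  · refine ae_of_all _ fun ω => Continuous.continuousOn ?_
    exact (continuous_const.max continuous_id).rpow_const fun _ => Or.inr hq.le

/-- Truncating `f` from below at a suitable level `s` makes its `L ^ q` norm at most `c > 1` times
its `L ^ 1` norm, with equality unless no truncation is needed. -/
lemma exists_truncation_level {f : Ω → ℝ} {c : ℝ} (hq : 1 < q) (hc : 1 < c)
    (hf : MemLp f (ENNReal.ofReal q) P) (h0 : ∀ ω, 0 ≤ f ω) :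
    ∃ s : ℝ, 0 ≤ s ∧ ∫ ω, max (f ω) s ^ q ∂P ≤ (c * ∫ ω, max (f ω) s ∂P) ^ q ∧
      (s = 0 ∨ ∫ ω, max (f ω) s ^ q ∂P = (c * ∫ ω, max (f ω) s ∂P) ^ q) := by
  have hq0 : 0 < q := by linarith
  have hf1 : MemLp f (ENNReal.ofReal 1) P := hf.mono_exponent (ENNReal.ofReal_le_ofReal hq.le)
  set F : ℝ → ℝ := fun s => ∫ ω, max (f ω) s ^ q ∂P
  set G : ℝ → ℝ := fun s => (c * ∫ ω, max (f ω) s ∂P) ^ q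
  by_cases hz : F 0 ≤ G 0
  · exact ⟨0, le_rfl, hz, Or.inl rfl⟩
  set A := ∫ ω, f ω ^ q ∂P
  have hfi := hf.integrable_rpow_of_nonneg hq0 (ae_of_all _ h0)
  have hA : 0 ≤ A := integral_nonneg fun ω => Real.rpow_nonneg (h0 ω) _
  have hcq : 1 < c ^ q := Real.one_lt_rpow hc hq0
  -- Chosen so that `A + b ^ q = c ^ q * b ^ q`, which separates `F b ≤ A + b ^ q` from `c ^ q * b ^
  -- q ≤ G b`; the intermediate value theorem then applies on `[0, b]`.
  set b := (A / (c ^ q - 1)) ^ (1 / q) with hb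
  have hAd : 0 ≤ A / (c ^ q - 1) := div_nonneg hA (by linarith)
  have hb0 : 0 ≤ b := Real.rpow_nonneg hAd _
  have hbq : b ^ q = A / (c ^ q - 1) := by
    rw [hb, one_div, Real.rpow_inv_rpow hAd hq0.ne']
  have hFb : F b ≤ A + b ^ q := by
    have : A + b ^ q = ∫ ω, (f ω ^ q + b ^ q) ∂P := by
      rw [integral_add hfi (integrable_const _)]; simp [A]
    rw [this]
    refine integral_mono ((hf.max_const b).integrable_rpow_of_nonneg hq0
      (ae_of_all _ fun ω => (h0 ω).trans (le_max_left _ _))) (hfi.add (integrable_const _)) ?_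
    intro ω
    have h1 := Real.rpow_nonneg (h0 ω) q
    have h2 := Real.rpow_nonneg hb0 q
    rcases max_choice (f ω) b with h | h <;> simp only [h] <;> linarith
  have hGb : c ^ q * b ^ q ≤ G b := by
    rw [← Real.mul_rpow (by linarith) hb0]
    refine Real.rpow_le_rpow (by positivity) (mul_le_mul_of_nonneg_left ?_ (by linarith)) hq0.le
    have := integral_mono (μ := P) (integrable_const b) ((hf.max_const b).integrable_of_one_le hq)
      (fun ω => le_max_right _ _)
    simpa using this
  have hle : F b ≤ G b := by
    have : (c ^ q - 1) * b ^ q = A := by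
      rw [hbq, mul_div_cancel₀ _ (sub_pos.2 hcq).ne']
    linarith
  have hF : ContinuousOn F (Set.Icc 0 b) := continuousOn_integral_max_rpow hq0 hf h0 b
  have hG : ContinuousOn G (Set.Icc 0 b) := by
    have h := continuousOn_integral_max_rpow one_pos hf1 h0 b
    simp only [Real.rpow_one] at h
    exact (continuousOn_const.mul h).rpow_const fun _ _ => Or.inr hq0.le
  obtain ⟨s, hs, he⟩ := intermediate_value_Icc' hb0 (hF.sub hG)
    (show (0 : ℝ) ∈ Set.Icc (F b - G b) (F 0 - G 0) from ⟨by linarith, by linarith⟩)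
  have he' : F s = G s := sub_eq_zero.1 he
  exact ⟨s, hs.1, he'.le, Or.inr he'⟩

end Truncation

/-! ### Feasible densities as an `L ^ q` constraint; the upper bound. -/

section Feasible

variable {Ω : Type*} [MeasurableSpace Ω] {P : Measure Ω} {p q α : ℝ} {W : Ω → ℝ}

lemma IsEVaRFeasible.memLp (hpq : p.HolderConjugate q) (hW : IsEVaRFeasible P α p W) :
    MemLp W (ENNReal.ofReal q) P := by
  have hi := hW.integrable_rpow
  rw [hpq.conjExponent_eq] at hi
  exact memLp_of_integrable_rpow hpq.symm.pos hW.isDensity.integrable.1 hW.isDensity.nonneg hi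

lemma renyiEntropy_eq (hpq : p.HolderConjugate q) :
    renyiEntropy P p.conjExponent W = 1 / (q - 1) * Real.log (∫ ω, W ω ^ q ∂P) := by
  rw [renyiEntropy, hpq.conjExponent_eq, if_neg hpq.symm.ne_zero, if_neg hpq.symm.lt.ne']

lemma IsEVaRFeasible.integral_rpow_rpow_le (hpq : p.HolderConjugate q) (hα1 : α < 1)
    (hW : IsEVaRFeasible P α p W) :
    (∫ ω, W ω ^ q ∂P) ^ (1 / q) ≤ (1 / (1 - α)) ^ (1 / p) := by
  have hβ : 0 < 1 / (1 - α) := one_div_pos.2 (by linarith)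
  have h0 : 0 ≤ ∫ ω, W ω ^ q ∂P := integral_nonneg_of_ae <| by
    filter_upwards [hW.isDensity.nonneg] with ω hω using Real.rpow_nonneg hω _
  rcases h0.eq_or_lt with h | h
  · rw [← h, Real.zero_rpow hpq.symm.one_div_ne_zero]
    positivity
  have he := hW.entropy_le
  rw [renyiEntropy_eq hpq, one_div, inv_mul_le_iff₀ hpq.symm.sub_one_pos,
    ← Real.log_rpow hβ, Real.log_le_log_iff h (by positivity)] at he
  rw [← hpq.sub_one_div_self, Real.rpow_mul hβ.le]
  exact Real.rpow_le_rpow h0 he hpq.symm.one_div_nonneg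

lemma IsDensity.isEVaRFeasible (hpq : p.HolderConjugate q) (hα0 : 0 ≤ α) (hα1 : α < 1)
    (hW : IsDensity P W) (hLp : MemLp W (ENNReal.ofReal q) P)
    (hle : ∫ ω, W ω ^ q ∂P ≤ ((1 / (1 - α)) ^ (1 / p)) ^ q) : IsEVaRFeasible P α p W := by
  have hβ : 0 < 1 / (1 - α) := one_div_pos.2 (by linarith)
  refine ⟨hW, ?_, ?_⟩
  · rw [hpq.conjExponent_eq]
    exact hLp.integrable_rpow_of_nonneg hpq.symm.pos hW.nonneg
  have h0 : 0 ≤ ∫ ω, W ω ^ q ∂P := integral_nonneg_of_ae <| by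
    filter_upwards [hW.nonneg] with ω hω using Real.rpow_nonneg hω _
  rw [renyiEntropy_eq hpq]
  rcases h0.eq_or_lt with h | h
  -- A degenerate case, impossible for a density in `L ^ q`, but settled at once by `Real.log 0 =
  -- 0`.
  · rw [← h, Real.log_zero, mul_zero]
    exact Real.log_nonneg ((one_le_div (by linarith)).2 (by linarith))
  rw [hpq.rpow_one_div_rpow hβ.le] at hle
  rw [one_div (q - 1), inv_mul_le_iff₀ hpq.symm.sub_one_pos, ← Real.log_rpow hβ]
  exact Real.log_le_log h hle

lemma one_le_one_div_one_sub_rpow (hp : 0 ≤ p) (hα0 : 0 ≤ α) (hα1 : α < 1) :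
    1 ≤ (1 / (1 - α)) ^ (1 / p) :=
  Real.one_le_rpow ((one_le_div (by linarith)).2 (by linarith)) (by positivity)

lemma one_lt_one_div_one_sub_rpow (hp : 0 < p) (hα0 : 0 < α) (hα1 : α < 1) :
    1 < (1 / (1 - α)) ^ (1 / p) :=
  Real.one_lt_rpow ((one_lt_div (by linarith)).2 (by linarith)) (by positivity)

lemma isEVaRFeasible_one [IsProbabilityMeasure P] (hpq : p.HolderConjugate q) (hα0 : 0 ≤ α)
    (hα1 : α < 1) : IsEVaRFeasible P α p (fun _ => 1) := by
  refine IsDensity.isEVaRFeasible hpq hα0 hα1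
    ⟨integrable_const _, ae_of_all _ fun _ => zero_le_one, by simp⟩ (memLp_const 1) ?_
  simpa using! Real.one_le_rpow (one_le_one_div_one_sub_rpow hpq.nonneg hα0 hα1) hpq.symm.nonneg

/-- A feasible density `W` with `|Z| ≤ K W` bounds the dual norm of `Z` by `K`. -/
lemma EVaRDualNorm_le_of_abs_le {Z : Ω → ℝ} {K : ℝ} (hpq : p.HolderConjugate q)
    (hW : IsEVaRFeasible P α p W) (hK : 0 ≤ K)
    (h : ∀ᵐ ω ∂P, |Z ω| ≤ K * W ω) : EVaRDualNorm P α p Z ≤ (K : EReal) := by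
  have := hpq.ennrealOfReal
  refine iSup_le fun Y => iSup_le fun hY => iSup_le fun hE => EReal.coe_le_coe_iff.2 ?_
  have h1 : ∫ ω, |Y ω| * W ω ∂P ≤ 1 :=
    EReal.coe_le_coe_iff.1 ((le_iSup₂_of_le W hW le_rfl).trans hE)
  have hint : Integrable (fun ω => |Y ω| * W ω) P := hY.abs.integrable_mul (hW.memLp hpq)
  calc ∫ ω, Y ω * Z ω ∂P ≤ ∫ ω, K * (|Y ω| * W ω) ∂P := by
        by_cases hi : Integrable (fun ω => Y ω * Z ω) P
        · refine integral_mono_ae hi (hint.const_mul K) ?_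
          filter_upwards [h] with ω hω
          calc Y ω * Z ω ≤ |Y ω| * |Z ω| := (le_abs_self _).trans (abs_mul _ _).le
            _ ≤ |Y ω| * (K * W ω) := mul_le_mul_of_nonneg_left hω (abs_nonneg _)
            _ = K * (|Y ω| * W ω) := by ring
        -- `Z` is not assumed measurable here, so the product may fail to be integrable; its
        -- integral is then `0` by convention.
        · rw [integral_undef hi]
          refine integral_nonneg_of_ae ?_
          filter_upwards [hW.isDensity.nonneg] with ω hω
          exact mul_nonneg hK (mul_nonneg (abs_nonneg _) hω)
    _ = K * ∫ ω, |Y ω| * W ω ∂P := integral_const_mul _ _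
    _ ≤ K := mul_le_of_le_one_right hK h1

lemma EVaRDualNorm_nonneg {Z : Ω → ℝ} : 0 ≤ EVaRDualNorm P α p Z := by
  refine le_iSup_of_le 0 (le_iSup_of_le MemLp.zero (le_iSup_of_le ?_ (by simp)))
  refine iSup₂_le fun W _ => ?_
  simp

end Feasible

/-! ### The quotients and duality. -/

section Quotient

variable {Ω : Type*} [MeasurableSpace Ω] {P : Measure Ω} [IsProbabilityMeasure P] {p q α : ℝ}
  {Z : Ω → ℝ}

lemma max_add_sub_self {v t : ℝ} : max (t + v) 0 - t = max v (-t) := by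
  rw [← max_sub_sub_right, add_sub_cancel_left, zero_sub]

lemma max_rpow {x s r : ℝ} (hx : 0 ≤ x) (hs : 0 ≤ s) (hr : 0 ≤ r) :
    max (x ^ r) (s ^ r) = max x s ^ r :=
  ((Real.monotoneOn_rpow_Ici_of_exponent_nonneg hr).map_max hx hs).symm

lemma dualDen_eq (hpq : p.HolderConjugate q) (hZ : MemLp Z (ENNReal.ofReal q) P) (t : ℝ) :
    dualDen P α p Z t = t + (1 / (1 - α)) ^ (1 / p) *
      (∫ ω, max (|Z ω| ^ (q - 1)) (-t) ^ p ∂P) ^ (1 / p) := by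
  rw [dualDen, hpq.conjExponent_eq]
  simp only [max_add_sub_self]
  rw [((hZ.abs_rpow_sub_one hpq).max_const (-t)).toReal_eLpNorm_of_nonneg hpq.pos
    fun ω => (Real.rpow_nonneg (abs_nonneg _) _).trans (le_max_left _ _)]

lemma dualDen_of_nonneg (hpq : p.HolderConjugate q) (hZ : MemLp Z (ENNReal.ofReal q) P) {t : ℝ}
    (ht : 0 ≤ t) : dualDen P α p Z t = t + (1 / (1 - α)) ^ (1 / p) *
      (∫ ω, |Z ω| ^ q ∂P) ^ (1 / p) := by
  have h (ω) : max (|Z ω| ^ (q - 1)) (-t) ^ p = |Z ω| ^ q := by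
    rw [max_eq_left, hpq.rpow_sub_one_rpow (abs_nonneg _)]
    linarith [Real.rpow_nonneg (abs_nonneg (Z ω)) (q - 1)]
  rw [dualDen_eq hpq hZ]
  simp only [h]

lemma dualNum_of_nonneg (hpq : p.HolderConjugate q) (hZ : MemLp Z (ENNReal.ofReal q) P) {t : ℝ}
    (ht : 0 ≤ t) : dualNum P p Z t = t * ∫ ω, |Z ω| ∂P + ∫ ω, |Z ω| ^ q ∂P := by
  have h (ω) : max (t + |Z ω| ^ (q - 1)) 0 * |Z ω| = t * |Z ω| + |Z ω| ^ q := by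
    rw [max_eq_left (by positivity), add_mul,
      Real.rpow_eq_rpow_sub_one_mul (abs_nonneg _) hpq.symm.lt]
  rw [dualNum, hpq.conjExponent_eq]
  simp only [h]
  rw [integral_add ((hZ.abs_apply.integrable_of_one_le hpq.symm.lt).const_mul t)
    (hZ.abs_apply.integrable_rpow_of_nonneg hpq.symm.pos (ae_of_all _ fun _ => abs_nonneg _)),
    integral_const_mul]

lemma dualDen_neg_rpow (hpq : p.HolderConjugate q) (hZ : MemLp Z (ENNReal.ofReal q) P) {s : ℝ}
    (hs : 0 ≤ s) : dualDen P α p Z (-s ^ (q - 1)) = (1 / (1 - α)) ^ (1 / p) *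
      (∫ ω, max |Z ω| s ^ q ∂P) ^ (1 / p) - s ^ (q - 1) := by
  have h (ω) : max (|Z ω| ^ (q - 1)) (s ^ (q - 1)) ^ p = max |Z ω| s ^ q := by
    rw [max_rpow (abs_nonneg _) hs hpq.symm.sub_one_pos.le,
      hpq.rpow_sub_one_rpow (hs.trans (le_max_right _ _))]
  rw [dualDen_eq hpq hZ, neg_neg]
  simp only [h]
  ring

/-- The integrands agree pointwise: both vanish where `|Z| ≤ s`, and truncation has no effect
elsewhere. -/
lemma dualNum_neg_rpow (hpq : p.HolderConjugate q) (hZ : MemLp Z (ENNReal.ofReal q) P) {s : ℝ}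
    (hs : 0 ≤ s) : dualNum P p Z (-s ^ (q - 1)) =
      ∫ ω, max |Z ω| s ^ q ∂P - s ^ (q - 1) * ∫ ω, max |Z ω| s ∂P := by
  have h (ω) : max (-s ^ (q - 1) + |Z ω| ^ (q - 1)) 0 * |Z ω| =
      max |Z ω| s ^ q - s ^ (q - 1) * max |Z ω| s := by
    rcases le_total |Z ω| s with hz | hz
    · have := Real.rpow_le_rpow (abs_nonneg _) hz hpq.symm.sub_one_pos.le
      rw [max_eq_right hz, max_eq_right (by linarith),
        Real.rpow_eq_rpow_sub_one_mul hs hpq.symm.lt]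
      ring
    · have := Real.rpow_le_rpow hs hz hpq.symm.sub_one_pos.le
      rw [max_eq_left hz, max_eq_left (by linarith),
        Real.rpow_eq_rpow_sub_one_mul (abs_nonneg _) hpq.symm.lt]
      ring
  have hM := hZ.abs_apply.max_const s
  rw [dualNum, hpq.conjExponent_eq]
  simp only [h]
  rw [integral_sub (hM.integrable_rpow_of_nonneg hpq.symm.pos
    (ae_of_all _ fun _ => hs.trans (le_max_right _ _)))
    ((hM.integrable_of_one_le hpq.symm.lt).const_mul _), integral_const_mul]

lemma memLp_max_add (hpq : p.HolderConjugate q) (hZ : MemLp Z (ENNReal.ofReal q) P) (t : ℝ) :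
    MemLp (fun ω => max (t + |Z ω| ^ (q - 1)) 0) (ENNReal.ofReal p) P :=
  ((memLp_const t).add (hZ.abs_rpow_sub_one hpq)).max_const 0

/-- Weak duality: the denominator dominates `EVaR` of `(t + |Z| ^ (q - 1))₊`. -/
lemma integral_max_add_mul_le_dualDen {W : Ω → ℝ} (hpq : p.HolderConjugate q) (hα1 : α < 1)
    (hZ : MemLp Z (ENNReal.ofReal q) P) (hW : IsEVaRFeasible P α p W) (t : ℝ) :
    ∫ ω, max (t + |Z ω| ^ (q - 1)) 0 * W ω ∂P ≤ dualDen P α p Z t := by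
  have := hpq.ennrealOfReal
  have hV := (hZ.abs_rpow_sub_one hpq).max_const (-t)
  have h (ω) : max (t + |Z ω| ^ (q - 1)) 0 * W ω =
      t * W ω + max (|Z ω| ^ (q - 1)) (-t) * W ω := by
    rw [← max_add_sub_self]; ring
  have h0 : ∀ ω, 0 ≤ max (|Z ω| ^ (q - 1)) (-t) := fun ω =>
    (Real.rpow_nonneg (abs_nonneg _) _).trans (le_max_left _ _)
  simp only [h]
  rw [integral_add (hW.isDensity.integrable.const_mul t) (show Integrable (fun ω => _ * _) P from
      hV.integrable_mul (hW.memLp hpq)),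
    integral_const_mul, hW.isDensity.integral_eq_one, mul_one, dualDen_eq hpq hZ, mul_comm _
      ((∫ ω, max (|Z ω| ^ (q - 1)) (-t) ^ p ∂P) ^ (1 / p))]
  refine add_le_add_right ((integral_mul_le_Lp_mul_Lq_of_nonneg hpq (ae_of_all _ h0)
    hW.isDensity.nonneg hV (hW.memLp hpq)).trans ?_) t
  exact mul_le_mul_of_nonneg_left (hW.integral_rpow_rpow_le hpq hα1)
    (Real.rpow_nonneg (integral_nonneg fun ω => Real.rpow_nonneg (h0 ω) _) _)

/-- Weak duality tested on the constant density `1`. -/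
lemma dualDen_nonneg (hpq : p.HolderConjugate q) (hα0 : 0 ≤ α) (hα1 : α < 1)
    (hZ : MemLp Z (ENNReal.ofReal q) P) (t : ℝ) : 0 ≤ dualDen P α p Z t :=
  (integral_nonneg fun _ => by simp).trans
    (integral_max_add_mul_le_dualDen hpq hα1 hZ (isEVaRFeasible_one hpq hα0 hα1) t)

lemma dualNum_div_dualDen_le_EVaRDualNorm (hpq : p.HolderConjugate q) (hα0 : 0 ≤ α) (hα1 : α < 1)
    (hZ : MemLp Z (ENNReal.ofReal q) P) (t : ℝ) :
    ((dualNum P p Z t / dualDen P α p Z t : ℝ) : EReal) ≤ EVaRDualNorm P α p Z := by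
  have := hpq.ennrealOfReal
  rcases (dualDen_nonneg hpq hα0 hα1 hZ t).eq_or_lt with hD | hD
  -- Division by zero gives `0`, matching the convention for `0 / 0`.
  · rw [← hD, div_zero]
    exact EVaRDualNorm_nonneg
  set D := dualDen P α p Z t
  set U : Ω → ℝ := fun ω => max (t + |Z ω| ^ (q - 1)) 0
  have hU : MemLp U (ENNReal.ofReal p) P := memLp_max_add hpq hZ t
  have hU0 : ∀ ω, 0 ≤ U ω := fun ω => le_max_right _ _
  set Y : Ω → ℝ := fun ω => D⁻¹ * (Z ω / |Z ω| * U ω)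
  have hsgn : AEStronglyMeasurable (fun ω => Z ω / |Z ω|) P :=
    (hZ.1.aemeasurable.div hZ.1.norm.aemeasurable).aestronglyMeasurable
  have hsgn1 (x : ℝ) : |(x / |x|)| ≤ 1 := by
    rw [abs_div, abs_abs]
    exact div_self_le_one _
  have hYle (ω) : |Y ω| ≤ D⁻¹ * U ω := by
    rw [abs_mul, abs_mul, abs_of_pos (inv_pos.2 hD), abs_of_nonneg (hU0 ω)]
    exact mul_le_mul_of_nonneg_left (mul_le_of_le_one_left (hU0 ω) (hsgn1 _)) (inv_pos.2 hD).le
  have hUD : MemLp (fun ω => D⁻¹ * U ω) (ENNReal.ofReal p) P := hU.const_mul _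
  have hY : MemLp Y (ENNReal.ofReal p) P :=
    hUD.mono ((hsgn.mul hU.1).const_mul _)
      (ae_of_all _ fun ω => (hYle ω).trans (le_abs_self _))
  refine le_iSup_of_le Y (le_iSup_of_le hY (le_iSup_of_le ?_ (EReal.coe_le_coe_iff.2 ?_)))
  · refine iSup₂_le fun W hW => ?_
    rw [← EReal.coe_one, EReal.coe_le_coe_iff]
    calc ∫ ω, |Y ω| * W ω ∂P ≤ ∫ ω, D⁻¹ * (U ω * W ω) ∂P := by
          refine integral_mono_ae (hY.abs.integrable_mul (hW.memLp hpq))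
            ((hU.integrable_mul (hW.memLp hpq)).const_mul _) ?_
          filter_upwards [hW.isDensity.nonneg] with ω hω
          rw [← mul_assoc]
          exact mul_le_mul_of_nonneg_right (hYle ω) hω
      _ = D⁻¹ * ∫ ω, U ω * W ω ∂P := integral_const_mul _ _
      _ ≤ D⁻¹ * D := mul_le_mul_of_nonneg_left
          (integral_max_add_mul_le_dualDen hpq hα1 hZ hW t) (inv_pos.2 hD).le
      _ = 1 := inv_mul_cancel₀ hD.ne'
  · have h (ω) : Y ω * Z ω = D⁻¹ * (U ω * |Z ω|) := by
      have h1 : Z ω / |Z ω| * Z ω = |Z ω| := by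
        rw [div_mul_eq_mul_div, ← abs_mul_abs_self, mul_self_div_self]
      calc Y ω * Z ω = D⁻¹ * (U ω * (Z ω / |Z ω| * Z ω)) := by simp only [Y]; ring
        _ = D⁻¹ * (U ω * |Z ω|) := by rw [h1]
    simp only [h]
    rw [integral_const_mul, dualNum, hpq.conjExponent_eq, div_eq_inv_mul]

lemma dualDen_pos (hpq : p.HolderConjugate q) (hα0 : 0 < α) (hα1 : α < 1)
    (hZ : MemLp Z (ENNReal.ofReal q) P) (hne : ¬ Z =ᵐ[P] 0) (t : ℝ) :
    0 < dualDen P α p Z t := by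
  have hc := one_lt_one_div_one_sub_rpow hpq.pos hα0 hα1
  rcases le_or_gt 0 t with ht | ht
  · rw [dualDen_of_nonneg hpq hZ ht]
    have hA : 0 < ∫ ω, |Z ω| ^ q ∂P := by
      have h0 : 0 ≤ fun ω => |Z ω| ^ q := fun ω => Real.rpow_nonneg (abs_nonneg _) _
      refine (integral_nonneg h0).lt_of_ne' fun h => hne ?_
      rw [integral_eq_zero_iff_of_nonneg h0 (hZ.abs_apply.integrable_rpow_of_nonneg hpq.symm.pos
        (ae_of_all _ fun _ => abs_nonneg _))] at h
      filter_upwards [h] with ω hω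
      simpa using (Real.rpow_eq_zero (abs_nonneg _) hpq.symm.ne_zero).1 hω
    have := mul_pos (zero_lt_one.trans hc) (Real.rpow_pos_of_pos hA (1 / p))
    linarith
  · rw [dualDen_eq hpq hZ]
    have hV := (hZ.abs_rpow_sub_one hpq).max_const (-t)
    have h1 := integral_le_integral_rpow_rpow hpq.symm hV
      (ae_of_all _ fun ω => (Real.rpow_nonneg (abs_nonneg _) _).trans (le_max_left _ _))
    have h2 := integral_mono (μ := P) (integrable_const (-t)) (hV.integrable_of_one_le hpq.lt)
      fun ω => le_max_right _ _
    -- The norm is at least `-t > 0`, so multiplying it by `c > 1` makes the sum with `t` strictly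
    -- positive.
    have h3 : -t ≤ (∫ ω, max (|Z ω| ^ (q - 1)) (-t) ^ p ∂P) ^ (1 / p) := by
      simpa using h2.trans h1
    nlinarith

/-! ### Sharpness of the quotients. -/

/-- The value of the quotients in the limit `t → ∞`. -/
lemma integral_abs_le_iSup (hpq : p.HolderConjugate q) (hZ : MemLp Z (ENNReal.ofReal q) P) :
    ((∫ ω, |Z ω| ∂P : ℝ) : EReal) ≤
      ⨆ t : ℝ, ((dualNum P p Z t / dualDen P α p Z t : ℝ) : EReal) := by
  set K := ∫ ω, |Z ω| ∂P
  set A := ∫ ω, |Z ω| ^ q ∂P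
  set B := (1 / (1 - α)) ^ (1 / p) * A ^ (1 / p)
  have hlim : Filter.Tendsto (fun t : ℝ => (K + A / t) / (1 + B / t)) Filter.atTop (nhds K) := by
    have h (a : ℝ) : Filter.Tendsto (fun t : ℝ => a / t) Filter.atTop (nhds 0) :=
      tendsto_const_nhds.div_atTop Filter.tendsto_id
    simpa using! ((h A).const_add K).div ((h B).const_add 1) (by simp)
  refine le_of_tendsto ((continuous_coe_real_ereal.tendsto K).comp hlim) ?_
  filter_upwards [Filter.eventually_gt_atTop 0] with t ht
  refine le_iSup_of_le t (le_of_eq ?_)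
  rw [dualNum_of_nonneg hpq hZ ht.le, dualDen_of_nonneg hpq hZ ht.le, Function.comp_apply]
  congr 1
  rw [← mul_div_mul_left (K + A / t) (1 + B / t) ht.ne']
  congr 1 <;> field_simp <;> rfl

/-- At a level where the truncated variable has `L ^ q` norm equal to `c` times its expectation,
the quotient is that expectation. -/
lemma dualNum_div_dualDen_of_eq (hpq : p.HolderConjugate q) (hα0 : 0 < α) (hα1 : α < 1)
    (hZ : MemLp Z (ENNReal.ofReal q) P) (hne : ¬ Z =ᵐ[P] 0) {s : ℝ} (hs : 0 ≤ s)
    (he : ∫ ω, max |Z ω| s ^ q ∂P = ((1 / (1 - α)) ^ (1 / p) * ∫ ω, max |Z ω| s ∂P) ^ q) :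
    dualNum P p Z (-s ^ (q - 1)) / dualDen P α p Z (-s ^ (q - 1)) = ∫ ω, max |Z ω| s ∂P := by
  have hK : 0 ≤ ∫ ω, max |Z ω| s ∂P := integral_nonneg fun _ => hs.trans (le_max_right _ _)
  have hc := one_lt_one_div_one_sub_rpow hpq.pos hα0 hα1
  rw [div_eq_iff (dualDen_pos hpq hα0 hα1 hZ hne _).ne', dualNum_neg_rpow hpq hZ hs,
    dualDen_neg_rpow hpq hZ hs, he]
  set c := (1 / (1 - α)) ^ (1 / p)
  set K := ∫ ω, max |Z ω| s ∂P
  have hcK : 0 ≤ c * K := mul_nonneg (by linarith) hK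
  rw [hpq.rpow_rpow_one_div hcK, Real.rpow_eq_rpow_sub_one_mul hcK hpq.symm.lt]
  ring

/-- Here `c = 1`. With `M = max |Z| s` and `a = ‖M‖_q > s`, the denominator is `a ^ (q - 1) - s ^ (q
- 1)`, and `E M ≤ a` makes the numerator at least `a` times it. -/
lemma le_dualNum_div_dualDen_zero (hpq : p.HolderConjugate q)
    (hZ : MemLp Z (ENNReal.ofReal q) P) {s : ℝ} (hs : 0 ≤ s) (hlt : ¬ ∀ᵐ ω ∂P, |Z ω| ≤ s) :
    s ≤ dualNum P p Z (-s ^ (q - 1)) / dualDen P 0 p Z (-s ^ (q - 1)) := by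
  have hM := hZ.abs_apply.max_const s
  have hM0 (ω) : 0 ≤ max |Z ω| s := hs.trans (le_max_right _ _)
  have hMi := hM.integrable_rpow_of_nonneg hpq.symm.pos (ae_of_all _ hM0)
  have hEM := integral_le_integral_rpow_rpow hpq hM (ae_of_all _ hM0)
  have hle (ω) : s ^ q ≤ max |Z ω| s ^ q := Real.rpow_le_rpow hs (le_max_right _ _) hpq.symm.nonneg
  have hA : s ^ q < ∫ ω, max |Z ω| s ^ q ∂P := by
    have h1 := integral_mono (μ := P) (integrable_const (s ^ q)) hMi hle
    rw [integral_const, probReal_univ, one_smul] at h1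
    refine h1.lt_of_ne fun h => hlt ?_
    have h2 : ∫ ω, (max |Z ω| s ^ q - s ^ q) ∂P = 0 := by
      rw [integral_sub hMi (integrable_const _), ← h]; simp
    rw [integral_eq_zero_iff_of_nonneg (fun ω => sub_nonneg.2 (hle ω))
      (hMi.sub (integrable_const _))] at h2
    filter_upwards [h2] with ω hω
    have h3 : max |Z ω| s = s :=
      (Real.rpow_left_inj (hM0 ω) hs hpq.symm.ne_zero).1 (sub_eq_zero.1 hω)
    exact max_eq_right_iff.1 h3
  set A := ∫ ω, max |Z ω| s ^ q ∂P
  have hA0 : 0 < A := (Real.rpow_nonneg hs _).trans_lt hA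
  set a := A ^ (1 / q) with ha
  have ha0 : 0 ≤ a := Real.rpow_nonneg hA0.le _
  have haq : a ^ q = A := by rw [ha, one_div, Real.rpow_inv_rpow hA0.le hpq.symm.ne_zero]
  have hsa : s < a := by
    rwa [← haq, Real.rpow_lt_rpow_iff hs ha0 hpq.symm.pos] at hA
  have hpow := Real.rpow_lt_rpow hs hsa hpq.symm.sub_one_pos
  have hden : dualDen P 0 p Z (-s ^ (q - 1)) = a ^ (q - 1) - s ^ (q - 1) := by
    rw [dualDen_neg_rpow hpq hZ hs, ← hpq.rpow_rpow_one_div ha0, haq]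
    simp [A]
  rw [hden, le_div_iff₀ (sub_pos.2 hpow), dualNum_neg_rpow hpq hZ hs]
  have h1 := mul_le_mul_of_nonneg_left hEM (Real.rpow_nonneg hs (q - 1))
  have h2 := mul_le_mul_of_nonneg_right hsa.le (sub_pos.2 hpow).le
  have h3 := Real.rpow_eq_rpow_sub_one_mul ha0 hpq.symm.lt
  rw [haq] at h3
  change _ ≤ A - _
  linarith

lemma EVaRDualNorm_zero_le_iSup (hpq : p.HolderConjugate q)
    (hZ : MemLp Z (ENNReal.ofReal q) P) :
    EVaRDualNorm P 0 p Z ≤ ⨆ t : ℝ, ((dualNum P p Z t / dualDen P 0 p Z t : ℝ) : EReal) := by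
  set S := ⨆ t : ℝ, ((dualNum P p Z t / dualDen P 0 p Z t : ℝ) : EReal)
  have hS0 : 0 ≤ S := by
    refine le_trans ?_ (integral_abs_le_iSup (α := 0) hpq hZ)
    exact_mod_cast integral_nonneg fun ω => abs_nonneg (Z ω)
  induction hS : S with
  | bot => simp [hS] at hS0
  | top => exact le_top
  | coe K =>
    rw [hS] at hS0
    have hK : 0 ≤ K := by exact_mod_cast hS0
    refine EVaRDualNorm_le_of_abs_le hpq (isEVaRFeasible_one hpq le_rfl one_pos) hK ?_
    -- The quotient bound needs a level strictly above `K` to contradict the supremum; countably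
    -- many such levels give `|Z| ≤ K` almost surely.
    have h (n : ℕ) : ∀ᵐ ω ∂P, |Z ω| ≤ K + 1 / ((n : ℝ) + 1) := by
      by_contra hn
      have hpos : 0 < 1 / ((n : ℝ) + 1) := Nat.one_div_pos_of_nat
      have h1 := le_dualNum_div_dualDen_zero hpq hZ (add_nonneg hK hpos.le) hn
      have h2 : (((K + 1 / ((n : ℝ) + 1) : ℝ)) : EReal) ≤ (K : ℝ) := by
        rw [← hS]
        exact le_iSup_of_le _ (EReal.coe_le_coe_iff.2 h1)
      rw [EReal.coe_le_coe_iff] at h2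
      linarith
    filter_upwards [ae_all_iff.2 h] with ω hω
    rw [mul_one]
    have hlim := (tendsto_one_div_add_atTop_nhds_zero_nat (𝕜 := ℝ)).const_add K
    rw [add_zero] at hlim
    exact ge_of_tendsto' hlim hω

lemma exists_EVaRDualNorm_le (hpq : p.HolderConjugate q) (hα0 : 0 < α) (hα1 : α < 1)
    (hZ : MemLp Z (ENNReal.ofReal q) P) :
    ∃ K : ℝ, EVaRDualNorm P α p Z ≤ (K : EReal) ∧
      (K : EReal) ≤ ⨆ t : ℝ, ((dualNum P p Z t / dualDen P α p Z t : ℝ) : EReal) := by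
  have habs := integral_abs_le_iSup (α := α) hpq hZ
  by_cases hne : Z =ᵐ[P] 0
  · refine ⟨0, EVaRDualNorm_le_of_abs_le hpq (isEVaRFeasible_one hpq hα0.le hα1) le_rfl ?_,
      le_trans ?_ habs⟩
    · filter_upwards [hne] with ω hω
      simp [hω]
    · exact_mod_cast integral_nonneg fun ω => abs_nonneg (Z ω)
  have hc := one_lt_one_div_one_sub_rpow hpq.pos hα0 hα1
  obtain ⟨s, hs, hle, hcase⟩ := exists_truncation_level hpq.symm.lt hc hZ.abs_apply
    fun ω => abs_nonneg _
  have hM := hZ.abs_apply.max_const s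
  have hM0 (ω) : 0 ≤ max |Z ω| s := hs.trans (le_max_right _ _)
  have hMi := hM.integrable_of_one_le hpq.symm.lt
  have hK : 0 < ∫ ω, max |Z ω| s ∂P := by
    refine (integral_nonneg hM0).lt_of_ne' fun h => hne ?_
    rw [integral_eq_zero_iff_of_nonneg hM0 hMi] at h
    filter_upwards [h] with ω hω
    exact abs_nonpos_iff.1 ((le_max_left _ _).trans hω.le)
  set K := ∫ ω, max |Z ω| s ∂P
  refine ⟨K, EVaRDualNorm_le_of_abs_le (W := fun ω => K⁻¹ * max |Z ω| s) hpq
    (IsDensity.isEVaRFeasible hpq hα0.le hα1 ⟨hMi.const_mul _, ae_of_all _ fun ω =>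
      mul_nonneg (inv_pos.2 hK).le (hM0 ω), ?_⟩ (hM.const_mul _) ?_) hK.le ?_, ?_⟩
  · rw [integral_const_mul, inv_mul_cancel₀ hK.ne']
  · simp only [Real.mul_rpow (inv_pos.2 hK).le (hM0 _)]
    rw [integral_const_mul, Real.inv_rpow hK.le, inv_mul_le_iff₀ (Real.rpow_pos_of_pos hK _),
      ← Real.mul_rpow hK.le (by linarith), mul_comm]
    exact hle
  · refine ae_of_all _ fun ω => ?_
    rw [mul_inv_cancel_left₀ hK.ne']
    exact le_max_left _ _
  · rcases hcase with rfl | he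
    · simpa [K] using habs
    · exact le_iSup_of_le _
        (EReal.coe_le_coe_iff.2 (dualNum_div_dualDen_of_eq hpq hα0 hα1 hZ hne hs he).ge)

end Quotient

theorem mainTheorem7 {Ω : Type*} [MeasurableSpace Ω] (P : Measure Ω) [IsProbabilityMeasure P]
    (p : ℝ) (hp : 1 < p) (α : ℝ) (hα0 : 0 ≤ α) (hα1 : α < 1)
    (Z : Ω → ℝ) (hZ : MemLp Z (ENNReal.ofReal p.conjExponent) P) :
    (EVaRDualNorm P α p Z = ⨆ t : ℝ, ((dualNum P p Z t / dualDen P α p Z t : ℝ) : EReal)) ∧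
    (0 < α → EVaRDualNorm P α p Z < ⊤) ∧
    (0 < α → ¬ Z =ᵐ[P] 0 → ∀ t : ℝ, 0 < dualDen P α p Z t) := by
  have hpq := Real.HolderConjugate.conjExponent hp
  refine ⟨le_antisymm ?_ (iSup_le (dualNum_div_dualDen_le_EVaRDualNorm hpq hα0 hα1 hZ)),
    fun h => ?_, fun h hne t => dualDen_pos hpq h hα1 hZ hne t⟩
  · rcases hα0.eq_or_lt with rfl | h
    · exact EVaRDualNorm_zero_le_iSup hpq hZ
    · obtain ⟨K, h1, h2⟩ := exists_EVaRDualNorm_le hpq h hα1 hZ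
      exact h1.trans h2
  · obtain ⟨K, h1, -⟩ := exists_EVaRDualNorm_le hpq h hα1 hZ
    exact h1.trans_lt (EReal.coe_lt_top K)
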